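/- Let $n\ge 0$ and let $\mathbb{Q}\langle X_n\rangle=\mathbb{Q}\langle x_1,\dots,x_n\rangle$ be the algebra of polynomials in $n$ noncommuting variables, graded by degree, with the symmetric group $\mathfrak{S}_n$ acting by permuting the variables. For a variable $x$, let $\partial_x$ be the Hausdorff derivative: the linear operator sending a word $w$ to the sum, over all occurrences of the letter $x$ in $w$, of the word obtained from $w$ by deleting that occurrence. Let $$\mathcal{A}'_n=\bigcap_{i=1}^n\ker\partial_{x_i}\subseteq\mathbb{Q}\langle X_n\rangle ,$$ a graded $\mathfrak{S}_n$-submodule of $\mathbb{Q}\langle X_n\rangle$ with finite-dimensional homogeneous components $(\mathcal{A}'_n)_k$. Let $\mathit{Sym}=\mathbb{Q}[[q]][p_1,p_2,\dots]$ be the ring of symmetric functions, $p_k$ being the power sums, let $h_m$ be the complete homogeneous symmetric functions, and write $h_{(n-d,1^d)}=h_{n-d}h_1^d$. For $f\in\mathit{Sym}$ let $f[X(1-q)]$ be the image of $f$ under the $\mathbb{Q}[[q]]$-algebra endomorphism $p_k\mapsto(1-q^k)p_k$, and put $\{q;q\}_d=(1-q)(1-2q)\cdots(1-dq)$. Define the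 graded Frobenius characteristic by $$\mathrm{Frob}_{\mathfrak{S}_n}(\mathcal{A}'_n)=\frac1{n!}\sum_{\sigma\in\mathfrak{S}_n}\Big(\sum_{k\ge0}\mathrm{tr}\big(\sigma|_{(\mathcal{A}'_n)_k}\big)q^k\Big)p_{\lambda(\sigma)},$$ where $\lambda(\sigma)$ is the cycle type of $\sigma$. Then $$\mathrm{Frob}_{\mathfrak{S}_n}(\mathcal{A}'_n)=\sum_{d=0}^n\frac{q^d}{\{q;q\}_d}\,h_{(n-d,1^d)}[X(1-q)].$$ -/

import Mathlib

noncomputable section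

namespace NCHarmonics

/-! ### Symmetric functions -/

/-- The ring of symmetric functions `Sym = R[p₁, p₂, p₃, …]` with coefficients in the ring
`R = ℚ⟦q⟧` of formal power series in `q`: polynomials in the power sums. -/
abbrev SymFn : Type := MvPolynomial ℕ+ (PowerSeries ℚ)

/-- The power sum symmetric function `p_k`, for `k ≥ 1`. -/
def p (k : ℕ) : SymFn := MvPolynomial.X k.toPNat'

/-- The power sum symmetric function `p_μ = ∏ p_{μ_i}` of a partition `μ`. -/
def pPart {m : ℕ} (μ : m.Partition) : SymFn := (μ.parts.map p).prod

/-- `z_μ = ∏_i n_i(μ)! i^{n_i(μ)}`, where `n_i(μ)` is the number of parts of `μ` of size `i`. -/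
def z {m : ℕ} (μ : m.Partition) : ℕ :=
  ∏ i ∈ μ.parts.toFinset, (μ.parts.count i).factorial * i ^ μ.parts.count i

/-- The complete homogeneous symmetric function `h_m = ∑_{μ ⊢ m} p_μ / z_μ`, written in the power
sums (see `eval_h` for the comparison with complete homogeneous polynomials). -/
def h (m : ℕ) : SymFn := ∑ μ : m.Partition, ((z μ : ℚ)⁻¹) • pPart μ

lemma z_cons {m m' : ℕ} (k : ℕ) (ν : m.Partition) (μ : m'.Partition)
    (hμ : μ.parts = k ::ₘ ν.parts) : z μ = k * (ν.parts.count k + 1) * z ν := by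
  have key : ∀ (s : Multiset ℕ) (F : Finset ℕ), s.toFinset ⊆ F →
      ∏ i ∈ s.toFinset, (s.count i).factorial * i ^ s.count i =
        ∏ i ∈ F, (s.count i).factorial * i ^ s.count i := by
    intro s F hF
    refine Finset.prod_subset hF fun i _ hi => ?_
    rw [Multiset.mem_toFinset] at hi
    simp [Multiset.count_eq_zero_of_notMem hi]
  have hF1 : (k ::ₘ ν.parts).toFinset ⊆ insert k ν.parts.toFinset := by simp
  have hF2 : ν.parts.toFinset ⊆ insert k ν.parts.toFinset := Finset.subset_insert _ _
  rw [z, z, hμ, key _ _ hF1, key _ _ hF2,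
    ← Finset.mul_prod_erase _ _ (Finset.mem_insert_self k ν.parts.toFinset),
    ← Finset.mul_prod_erase (insert k ν.parts.toFinset)
      (fun i => (ν.parts.count i).factorial * i ^ ν.parts.count i) (Finset.mem_insert_self k _)]
  have : ∀ i ∈ (insert k ν.parts.toFinset).erase k,
      ((k ::ₘ ν.parts).count i).factorial * i ^ (k ::ₘ ν.parts).count i =
        (ν.parts.count i).factorial * i ^ ν.parts.count i := by
    intro i hi
    rw [Multiset.count_cons_of_ne (Finset.ne_of_mem_erase hi)]
  rw [Finset.prod_congr rfl this, Multiset.count_cons_self, Nat.factorial_succ, pow_succ]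
  ring

lemma z_ne_zero {m : ℕ} (μ : m.Partition) : (z μ : ℚ) ≠ 0 := by
  rw [Nat.cast_ne_zero, z, Finset.prod_ne_zero_iff]
  intro i hi
  have := μ.parts_pos (Multiset.mem_toFinset.1 hi)
  positivity

lemma newton_h (m : ℕ) : (m : ℚ) • h m = ∑ k ∈ Finset.Icc 1 m, p k * h (m - k) := by
  have h1 : ∀ μ : m.Partition, (m : ℚ) • ((z μ : ℚ)⁻¹ • pPart μ) =
      ∑ k ∈ Finset.Icc 1 m, ((k * μ.parts.count k : ℕ) : ℚ) • ((z μ : ℚ)⁻¹ • pPart μ) := by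
    intro μ
    rw [← Finset.sum_smul, ← Nat.cast_sum]
    congr 2
    conv_lhs => rw [← μ.parts_sum, Finset.sum_multiset_count]
    rw [Finset.sum_subset (s₂ := Finset.Icc 1 m)]
    · exact Finset.sum_congr rfl fun i _ => by rw [smul_eq_mul, mul_comm]
    · intro i hi
      rw [Multiset.mem_toFinset] at hi
      exact Finset.mem_Icc.2 ⟨μ.parts_pos hi, μ.parts_sum ▸ Multiset.le_sum_of_mem hi⟩
    · intro i _ hi
      rw [Multiset.mem_toFinset] at hi
      simp [Multiset.count_eq_zero_of_notMem hi]
  rw [h, Finset.smul_sum, Finset.sum_congr rfl fun μ _ => h1 μ, Finset.sum_comm]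
  refine Finset.sum_congr rfl fun k hk => ?_
  obtain ⟨hk1, hkm⟩ := Finset.mem_Icc.1 hk
  rw [h, Finset.mul_sum]
  symm
  refine Finset.sum_of_injOn
    (fun ν : (m - k).Partition => (⟨k ::ₘ ν.parts,
      fun {i} hi => (Multiset.mem_cons.1 hi).elim (fun e => e ▸ hk1) ν.parts_pos,
      by rw [Multiset.sum_cons, ν.parts_sum]; omega⟩ : m.Partition)) ?_ ?_ ?_ ?_
  · intro ν _ ν' _ e
    have := congrArg Nat.Partition.parts e
    exact Nat.Partition.ext (by simpa using this)
  · intro _ _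
    simp
  · intro μ _ hμ
    have : k ∉ μ.parts := by
      intro hmem
      refine hμ ⟨⟨μ.parts.erase k, fun {i} hi => μ.parts_pos (Multiset.mem_of_mem_erase hi), ?_⟩,
        by simp, ?_⟩
      · have := congrArg Multiset.sum (Multiset.cons_erase hmem)
        rw [Multiset.sum_cons, μ.parts_sum] at this
        omega
      · exact Nat.Partition.ext (Multiset.cons_erase hmem)
    simp [Multiset.count_eq_zero_of_notMem this]
  · intro ν _
    have hz := z_cons (m' := m) k ν ⟨k ::ₘ ν.parts,
      fun {i} hi => (Multiset.mem_cons.1 hi).elim (fun e => e ▸ hk1) ν.parts_pos,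
      by rw [Multiset.sum_cons, ν.parts_sum]; omega⟩ rfl
    have hk0 : (k : ℚ) ≠ 0 := by exact_mod_cast (by omega : k ≠ 0)
    have hc : ((ν.parts.count k : ℚ) + 1) ≠ 0 := by positivity
    have hz0 := z_ne_zero ν
    simp only [hz, pPart, Multiset.map_cons, Multiset.prod_cons, Multiset.count_cons_self,
      smul_smul, mul_smul_comm]
    congr 1
    push_cast
    field_simp

lemma newton_hsymm (σ R : Type*) [Fintype σ] [DecidableEq σ] [CommRing R] (m : ℕ) :
    (m : MvPolynomial σ R) * MvPolynomial.hsymm σ R m =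
      ∑ k ∈ Finset.Icc 1 m, MvPolynomial.psum σ R k * MvPolynomial.hsymm σ R (m - k) := by
  have h1 : ∀ s : Sym σ m, (m : MvPolynomial σ R) * (s.1.map MvPolynomial.X).prod =
      ∑ k ∈ Finset.Icc 1 m, ∑ i : σ,
        if k ≤ s.1.count i then (s.1.map MvPolynomial.X).prod else 0 := by
    intro s
    rw [Finset.sum_comm]
    have h2 : ∀ i : σ, (∑ k ∈ Finset.Icc 1 m, if k ≤ s.1.count i then
        ((s.1.map MvPolynomial.X).prod : MvPolynomial σ R) else 0) =
        (s.1.count i : MvPolynomial σ R) * (s.1.map MvPolynomial.X).prod := by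
      intro i
      have hle : s.1.count i ≤ m := (Multiset.count_le_card i s.1).trans_eq s.2
      have hf : (Finset.Icc 1 m).filter (fun k => k ≤ s.1.count i) =
          Finset.Icc 1 (s.1.count i) := by
        ext k
        simp only [Finset.mem_filter, Finset.mem_Icc]
        omega
      rw [← Finset.sum_filter, hf, Finset.sum_const, Nat.card_Icc, nsmul_eq_mul]
      simp
    rw [Finset.sum_congr rfl fun i _ => h2 i, ← Finset.sum_mul, ← Nat.cast_sum,
      Multiset.sum_count_eq_card fun _ _ => Finset.mem_univ _]
    congr 2
    exact s.2.symm
  rw [MvPolynomial.hsymm, Finset.mul_sum, Finset.sum_congr rfl fun s _ => h1 s, Finset.sum_comm]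
  refine Finset.sum_congr rfl fun k hk => ?_
  obtain ⟨hk1, hkm⟩ := Finset.mem_Icc.1 hk
  rw [Finset.sum_comm, MvPolynomial.psum, Finset.sum_mul]
  refine Finset.sum_congr rfl fun i _ => ?_
  rw [MvPolynomial.hsymm, Finset.mul_sum]
  symm
  refine Finset.sum_of_injOn
    (fun s : Sym σ (m - k) => (⟨Multiset.replicate k i + s.1, by
      rw [Multiset.card_add, Multiset.card_replicate, s.2]; omega⟩ : Sym σ m)) ?_ ?_ ?_ ?_
  · intro s _ s' _ e
    have := congrArg Subtype.val e
    exact Subtype.ext (by simpa using this)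
  · intro _ _
    exact Finset.mem_coe.2 (Finset.mem_univ _)
  · intro s _ hs
    rw [if_neg]
    intro hle
    have hle' : Multiset.replicate k i ≤ s.1 := Multiset.le_count_iff_replicate_le.1 hle
    refine hs ⟨⟨s.1 - Multiset.replicate k i, ?_⟩, Finset.mem_coe.2 (Finset.mem_univ _), ?_⟩
    · rw [Multiset.card_sub hle', Multiset.card_replicate, s.2]
    · exact Subtype.ext (add_tsub_cancel_of_le hle')
  · intro s _
    simp [Multiset.count_add]

/-- In any finite set of variables, `h_m` specializes to the complete homogeneous symmetric
polynomial when each `p_k` is specialized to the power sum polynomial. -/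
theorem eval_h (σ : Type*) [Fintype σ] [DecidableEq σ] (m : ℕ) :
    MvPolynomial.aeval (fun k : ℕ+ => MvPolynomial.psum σ (PowerSeries ℚ) k) (h m) =
      MvPolynomial.hsymm σ (PowerSeries ℚ) m := by
  induction m using Nat.strong_induction_on with
  | _ m ih =>
    rcases Nat.eq_zero_or_pos m with rfl | hm
    · rw [h, Fintype.sum_unique, Unique.default_eq (Nat.Partition.indiscrete 0)]
      simp [z, pPart]
    · have e := congrArg
        (MvPolynomial.aeval (fun k : ℕ+ => MvPolynomial.psum σ (PowerSeries ℚ) k)) (newton_h m)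
      have e2 : ∑ k ∈ Finset.Icc 1 m,
          MvPolynomial.aeval (fun k : ℕ+ => MvPolynomial.psum σ (PowerSeries ℚ) k)
            (p k * h (m - k)) = ∑ k ∈ Finset.Icc 1 m, MvPolynomial.psum σ (PowerSeries ℚ) k *
              MvPolynomial.hsymm σ (PowerSeries ℚ) (m - k) := by
        refine Finset.sum_congr rfl fun k hk => ?_
        obtain ⟨hk1, hkm⟩ := Finset.mem_Icc.1 hk
        rw [map_mul, ih (m - k) (by omega), p, MvPolynomial.aeval_X]
        rw [Nat.toPNat'_coe, if_pos (by omega)]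
      rw [map_sum, e2, ← newton_hsymm, Nat.cast_smul_eq_nsmul, map_nsmul, nsmul_eq_mul] at e
      have : CharZero (MvPolynomial σ (PowerSeries ℚ)) := algebraRat.charZero _
      have hne : (m : MvPolynomial σ (PowerSeries ℚ)) ≠ 0 := Nat.cast_ne_zero.2 hm.ne'
      exact mul_left_cancel₀ hne e

/-- `h_(a₁, …, a_l) = h_{a₁} ⋯ h_{a_l}`. -/
def hList (a : List ℕ) : SymFn := (a.map h).prod

/-- The plethystic substitution `f ↦ f[X(1-q)]`: the `ℚ⟦q⟧`-algebra endomorphism of `Sym`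
sending `p_k` to `(1 - q^k) p_k` for every `k ≥ 1`. -/
def plethOneSubQ : SymFn →ₐ[PowerSeries ℚ] SymFn :=
  MvPolynomial.aeval fun k : ℕ+ =>
    MvPolynomial.C (1 - PowerSeries.X ^ (k : ℕ)) * MvPolynomial.X k

/-- `{q;q}_d = (1-q)(1-2q)⋯(1-dq)`. Its constant term is `1`, so it is invertible in `ℚ⟦q⟧`. -/
def braceQ (d : ℕ) : PowerSeries ℚ :=
  ∏ i ∈ Finset.Icc 1 d, (1 - (i : PowerSeries ℚ) * PowerSeries.X)

/-! ### Noncommutative polynomials -/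

/-- The noncommutative polynomials `ℚ⟨x₁, …, x_n⟩`: the algebra of the free monoid of words. -/
abbrev NCPoly (n : ℕ) : Type := MonoidAlgebra ℚ (FreeMonoid (Fin n))

/-- The canonical action of the symmetric group on `ℚ⟨X_n⟩` by permutation of the variables:
`σ · x_{i₁} ⋯ x_{i_r} = x_{σ(i₁)} ⋯ x_{σ(i_r)}`. -/
def permRep (n : ℕ) : Representation ℚ (Equiv.Perm (Fin n)) (NCPoly n) where
  toFun σ := MonoidAlgebra.mapDomainLinearMap ℚ ℚ (FreeMonoid.map σ)
  map_one' := by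
    ext w
    simp [Equiv.Perm.coe_one]
  map_mul' σ τ := by
    rw [Equiv.Perm.coe_mul, FreeMonoid.map_comp, MonoidHom.coe_comp,
      MonoidAlgebra.mapDomainLinearMap_comp]
    rfl

/-- The sum, over the occurrences of the letter `x` in the word `w`, of the word obtained from `w`
by deleting that occurrence. -/
def deleteSum {n : ℕ} (x : Fin n) (w : FreeMonoid (Fin n)) : NCPoly n :=
  ∑ i ∈ Finset.range w.toList.length,
    if w.toList[i]? = some x then
      MonoidAlgebra.single (FreeMonoid.ofList (w.toList.eraseIdx i)) 1
    else 0

/-- The Hausdorff derivative `∂_x`, the linear extension of `deleteSum x`. -/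
def hausdorff {n : ℕ} (x : Fin n) : NCPoly n →ₗ[ℚ] NCPoly n :=
  Finsupp.linearCombination ℚ (deleteSum x) ∘ₗ
    (MonoidAlgebra.coeffLinearEquiv ℚ).toLinearMap

lemma hausdorff_single {n : ℕ} (x : Fin n) (w : FreeMonoid (Fin n)) :
    hausdorff x (MonoidAlgebra.single w 1) = deleteSum x w := by
  simp [hausdorff]

lemma hausdorff_permRep {n : ℕ} (x : Fin n) (σ : Equiv.Perm (Fin n)) (f : NCPoly n) :
    hausdorff (σ x) (permRep n σ f) = permRep n σ (hausdorff x f) := by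
  suffices H : hausdorff (σ x) ∘ₗ permRep n σ = permRep n σ ∘ₗ hausdorff x from
    LinearMap.congr_fun H f
  refine (MonoidAlgebra.coeffLinearEquiv (M := FreeMonoid (Fin n)) (S := ℚ) ℚ).symm.arrowCongr
    (LinearEquiv.refl ℚ (NCPoly n)) |>.symm.injective ?_
  refine Finsupp.lhom_ext' fun w => LinearMap.ext_ring ?_
  change hausdorff (σ x) (permRep n σ (MonoidAlgebra.single w 1)) =
    permRep n σ (hausdorff x (MonoidAlgebra.single w 1))
  have hs : ∀ v : FreeMonoid (Fin n), permRep n σ (MonoidAlgebra.single v 1) =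
      MonoidAlgebra.single (FreeMonoid.map σ v) 1 := fun v => by simp [permRep]
  rw [hs, hausdorff_single, hausdorff_single, deleteSum, deleteSum, map_sum]
  simp only [FreeMonoid.toList_map, List.length_map, List.getElem?_map, apply_ite (permRep n σ),
    map_zero, hs]
  refine Finset.sum_congr rfl fun i _ => ?_
  congr 1
  · cases w.toList[i]? <;> simp
  · rw [← FreeMonoid.ofList_map, List.eraseIdx_map]

/-- The space `A'_n = ⋂_x ker ∂_x`, as a subrepresentation of `ℚ⟨X_n⟩`. -/
def derivedEnveloping (n : ℕ) : Subrepresentation (permRep n) where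
  toSubmodule := ⨅ x : Fin n, LinearMap.ker (hausdorff x)
  apply_mem_toSubmodule σ f hf := by
    simp only [Submodule.mem_iInf, LinearMap.mem_ker] at hf ⊢
    intro x
    have := hausdorff_permRep (σ⁻¹ x) σ f
    rw [hf, map_zero] at this
    simpa using this

/-- The noncommutative polynomials that are homogeneous of degree `k`, i.e. linear combinations of
words of length `k`, as a subrepresentation of `ℚ⟨X_n⟩`. -/
def homogeneousPart (n k : ℕ) : Subrepresentation (permRep n) where
  toSubmodule := MonoidAlgebra.supported ℚ ℚ {w | w.length = k}
  apply_mem_toSubmodule σ f hf := by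
    classical
    rw [MonoidAlgebra.mem_supported] at hf ⊢
    intro v hv
    obtain ⟨w, hw, rfl⟩ := Finset.mem_image.1 (Finsupp.mapDomain_support hv)
    have := hf hw
    simp only [Set.mem_ofPred_eq, FreeMonoid.length] at this ⊢
    simpa using this

/-- The homogeneous components are finite-dimensional, so that traces on them are meaningful. -/
instance finite_inf_homogeneousPart {n : ℕ} (M : Subrepresentation (permRep n)) (k : ℕ) :
    Module.Finite ℚ (M ⊓ homogeneousPart n k).toSubmodule := by
  have hfin : ({w : FreeMonoid (Fin n) | w.length = k}).Finite :=
    List.finite_length_eq (Fin n) k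
  have : Finite {w : FreeMonoid (Fin n) | w.length = k} := hfin
  have h1 : Module.Finite ℚ (homogeneousPart n k).toSubmodule :=
    Module.Finite.equiv
      (MonoidAlgebra.supportedEquivFinsupp (R := ℚ) {w : FreeMonoid (Fin n) | w.length = k}).symm
  exact Submodule.finiteDimensional_of_le
    (S₂ := (homogeneousPart n k).toSubmodule) (fun _ hx => hx.2)

/-! ### The graded Frobenius characteristic -/

/-- The graded character `σ ↦ ∑_k tr(σ | M_k) q^k` of a (homogeneous) subrepresentation `M` of
`ℚ⟨X_n⟩`, where `M_k` is the homogeneous component of degree `k` of `M`. -/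
def gradedCharacter {n : ℕ} (M : Subrepresentation (permRep n)) (σ : Equiv.Perm (Fin n)) :
    PowerSeries ℚ :=
  PowerSeries.mk fun k => (M ⊓ homogeneousPart n k).toRepresentation.character σ

/-- The graded Frobenius characteristic `(1/n!) ∑_{σ ∈ 𝔖_n} χ_q^M(σ) p_{λ(σ)}`, where `λ(σ)` is the
cycle type of `σ` (fixed points included) and `χ_q^M` is the graded character of `M`. -/
def gradedFrob {n : ℕ} (M : Subrepresentation (permRep n)) : SymFn :=
  ((n.factorial : ℚ)⁻¹) •
    ∑ σ : Equiv.Perm (Fin n), MvPolynomial.C (gradedCharacter M σ) * pPart σ.partition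

end NCHarmonics

end

noncomputable section

namespace NCHarmonics

/-! The Hausdorff derivatives are commuting derivations of `ℚ⟨X_n⟩`, and the algebra behaves, as a
graded representation, like `A'_n` tensored with a commutative polynomial ring in `n` variables. To
see this, filter it by the order `d` at which all iterated derivatives vanish. Taking derivatives of
order `d` embeds the quotient of step `d + 1` by step `d` into the functions from multisets of `d`
letters to `A'_n`. This is onto (`symbol_surjective`), since the derivative indexed by a multiset
`β` sends `w * a`, with `w` a word of length `d` and `a` in `A'_n`, to a multiple of `a` that is
nonzero exactly when `β` is the multiset of letters of `w`.

Now take traces of a permutation `σ` of cycle type `λ` with `f` fixed points. The words contribute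
`1/(1 - f q)` and the multisets `1/∏(1 - q^{λ_i})`, so `A'_n` has graded character `∏(1 -
q^{λ_i})/(1 - f q)` (`gradedCharacter_derivedEnveloping`). The numerator times `p_λ` is
`p_λ[X(1-q)]`.

It remains to handle `1/(1 - f q)`. It equals `∑_d f(f-1)⋯(f-d+1) q^d/{q;q}_d`, a sum that
telescopes (`one_sub_mul_sum_braceQ`). Averaging over permutations turns into `∑_μ p_μ/z_μ`, and
inserting the falling factorial of the number of parts 1 acts as `p_1^d (∂/∂p_1)^d` on `h_n`, giving
`h_1^d h_{n-d}` (`sum_partition_descFactorial`). -/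

/-! ### Traces -/

/-- The trace is additive in short exact sequences. -/
lemma trace_eq_add_of_exact {K U V W : Type*} [Field K] [AddCommGroup U] [Module K U]
    [AddCommGroup V] [Module K V] [AddCommGroup W] [Module K W] [Module.Finite K U]
    [Module.Finite K V] [Module.Finite K W] {i : U →ₗ[K] V} {π : V →ₗ[K] W}
    (hi : Function.Injective i) (hπ : Function.Surjective π) (h : Function.Exact i π)
    {a : U →ₗ[K] U} {b : V →ₗ[K] V} {c : W →ₗ[K] W}
    (hab : b ∘ₗ i = i ∘ₗ a) (hbc : π ∘ₗ b = c ∘ₗ π) :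
    LinearMap.trace K V b = LinearMap.trace K U a + LinearMap.trace K W c := by
  obtain ⟨s, hs⟩ := π.exists_rightInverse_of_surjective (LinearMap.range_eq_top.2 hπ)
  obtain ⟨r, hr⟩ := i.exists_leftInverse_of_injective (LinearMap.ker_eq_bot.2 hi)
  have hsv : ∀ w, π (s w) = w := LinearMap.congr_fun hs
  have hru : ∀ u, r (i u) = u := LinearMap.congr_fun hr
  -- The retraction `r` is corrected so as to vanish on the image of `s`. Then `i ∘ r' + s ∘ π = id`
  -- splits `b`, and cyclicity of the trace moves each summand to `U` or `W`.
  set r' : V →ₗ[K] U := r ∘ₗ (LinearMap.id - s ∘ₗ π) with hr'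
  have hir : i ∘ₗ r' + s ∘ₗ π = LinearMap.id := by
    ext v
    obtain ⟨u, hu⟩ := (h (v - s (π v))).1 (by simp [hsv])
    simp [hr', ← hu, hru]
    simp [hu]
  have hri : r' ∘ₗ i = LinearMap.id := by
    ext u
    simp [hr', hru, (h (i u)).2 ⟨u, rfl⟩]
  have e : b = (i ∘ₗ a) ∘ₗ r' + (b ∘ₗ s) ∘ₗ π := by
    rw [← hab, LinearMap.comp_assoc, LinearMap.comp_assoc, ← LinearMap.comp_add, hir,
      LinearMap.comp_id]
  rw [e, map_add, LinearMap.trace_comp_comm', LinearMap.trace_comp_comm' π,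
    ← LinearMap.comp_assoc, ← LinearMap.comp_assoc, hri, hbc, LinearMap.comp_assoc, hs,
    LinearMap.comp_id, LinearMap.id_comp]

/-- The trace of the endomorphism `f ↦ (i ↦ a (f (τ i)))` of a space of functions. -/
lemma trace_pi_perm {K M ι : Type*} [Field K] [AddCommGroup M] [Module K M] [Module.Finite K M]
    [Fintype ι] [DecidableEq ι] (τ : ι → ι) (a : M →ₗ[K] M) :
    LinearMap.trace K (ι → M) (LinearMap.pi fun i => a ∘ₗ LinearMap.proj (τ i)) =
      (Finset.univ.filter fun i => τ i = i).card * LinearMap.trace K M a := by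
  classical
  let b := Module.finBasis K M
  rw [LinearMap.trace_eq_matrix_trace K (Pi.basis fun _ : ι => b),
    LinearMap.trace_eq_matrix_trace K b, Matrix.trace, Matrix.trace, Fintype.sum_sigma,
    Finset.card_filter, Nat.cast_sum, Finset.sum_mul]
  refine Finset.sum_congr rfl fun i _ => ?_
  rw [Finset.mul_sum]
  refine Finset.sum_congr rfl fun j _ => ?_
  -- The matrix is made of blocks, and the diagonal block at `i` is that of `a` if `τ i = i` and
  -- zero otherwise.
  by_cases hi : τ i = i <;>
    simp [LinearMap.toMatrix_apply, hi]

/-! ### Hausdorff derivatives -/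

lemma deleteSum_of_mul {n : ℕ} (x y : Fin n) (w : FreeMonoid (Fin n)) :
    deleteSum x (FreeMonoid.of y * w) =
      (if y = x then MonoidAlgebra.single w 1 else 0) +
        MonoidAlgebra.single (FreeMonoid.of y) 1 * deleteSum x w := by
  rw [deleteSum, deleteSum, FreeMonoid.toList_mul, FreeMonoid.toList_of, List.singleton_append,
    List.length_cons, Finset.sum_range_succ', add_comm, Finset.mul_sum]
  congr 1
  · simp
  · refine Finset.sum_congr rfl fun i _ => ?_
    simp only [List.getElem?_cons_succ, List.eraseIdx_cons_succ, mul_ite, mul_zero,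
      MonoidAlgebra.single_mul_single, mul_one]
    rfl

lemma hausdorff_of_mul {n : ℕ} (x y : Fin n) (a : NCPoly n) :
    hausdorff x (MonoidAlgebra.single (FreeMonoid.of y) 1 * a) =
      (if y = x then a else 0) + MonoidAlgebra.single (FreeMonoid.of y) 1 * hausdorff x a := by
  induction a using MonoidAlgebra.induction_linear with
  | zero => simp
  | add a b ha hb =>
    rw [mul_add, map_add, ha, hb, map_add, mul_add]
    split_ifs <;> abel
  | single w r =>
    have hr : (MonoidAlgebra.single w r : NCPoly n) = r • MonoidAlgebra.single w 1 := by simp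
    rw [hr, mul_smul_comm, map_smul, map_smul,
      MonoidAlgebra.single_mul_single, one_mul, hausdorff_single, hausdorff_single,
      deleteSum_of_mul, smul_add, mul_smul_comm]
    split_ifs <;> simp

lemma hausdorff_one {n : ℕ} (x : Fin n) : hausdorff x (1 : NCPoly n) = 0 := by
  rw [MonoidAlgebra.one_def, hausdorff_single, deleteSum]
  simp

/-- The Leibniz rule: the deleted letter lies either in the left factor or in the right one. -/
lemma hausdorff_single_mul {n : ℕ} (x : Fin n) (w : FreeMonoid (Fin n)) (a : NCPoly n) :
    hausdorff x (MonoidAlgebra.single w 1 * a) =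
      deleteSum x w * a + MonoidAlgebra.single w 1 * hausdorff x a := by
  induction w using FreeMonoid.inductionOn' with
  | one => simp [← MonoidAlgebra.one_def, ← hausdorff_single, hausdorff_one]
  | of_mul y w ih =>
    have e : (MonoidAlgebra.single (FreeMonoid.of y * w) 1 : NCPoly n) =
        MonoidAlgebra.single (FreeMonoid.of y) 1 * MonoidAlgebra.single w 1 := by
      rw [MonoidAlgebra.single_mul_single, mul_one]
    rw [e, mul_assoc, hausdorff_of_mul, ih, deleteSum_of_mul, add_mul, mul_add, ite_mul, zero_mul,
      mul_assoc, mul_assoc, add_assoc]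

/-- Two linear maps agree if they agree at `1` and their agreement is inherited by left multiples
by letters. -/
lemma linearMap_eq_of_letters {n : ℕ} {f g : NCPoly n →ₗ[ℚ] NCPoly n} (h1 : f 1 = g 1)
    (hmul : ∀ (y : Fin n) (a : NCPoly n), f a = g a →
      f (MonoidAlgebra.single (FreeMonoid.of y) 1 * a) =
        g (MonoidAlgebra.single (FreeMonoid.of y) 1 * a)) : f = g := by
  refine LinearMap.ext fun a => ?_
  induction a using MonoidAlgebra.induction_linear with
  | zero => simp
  | add a b ha hb => rw [map_add, map_add, ha, hb]
  | single w r =>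
    have hr : (MonoidAlgebra.single w r : NCPoly n) = r • MonoidAlgebra.single w 1 := by simp
    rw [hr, map_smul, map_smul]
    clear hr
    congr 1
    induction w using FreeMonoid.inductionOn' with
    | one => exact h1
    | of_mul y w ih =>
      have := hmul y _ ih
      rwa [MonoidAlgebra.single_mul_single, mul_one] at this

/-- On `z * a` the Leibniz rule gives two cross terms that are exchanged by swapping `x` and `y`,
plus `z` times the same composite at `a`. -/
lemma hausdorff_comm {n : ℕ} (x y : Fin n) :
    hausdorff x ∘ₗ hausdorff y = hausdorff y ∘ₗ hausdorff x := by
  refine linearMap_eq_of_letters (by simp [hausdorff_one]) fun z a h => ?_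
  simp only [LinearMap.comp_apply] at h ⊢
  rw [hausdorff_of_mul, hausdorff_of_mul, map_add, map_add, hausdorff_of_mul, hausdorff_of_mul, h]
  simp only [apply_ite (hausdorff x), apply_ite (hausdorff y), map_zero]
  abel

/-- Makes the fold in `iterHausdorff` independent of the order of the letters. -/
instance hausdorff_leftCommutative (n : ℕ) :
    LeftCommutative fun (x : Fin n) (f : NCPoly n →ₗ[ℚ] NCPoly n) => hausdorff x ∘ₗ f :=
  ⟨fun x y f => by rw [← LinearMap.comp_assoc, hausdorff_comm, LinearMap.comp_assoc]⟩

/-- The iterated Hausdorff derivative `∏_{x ∈ β} ∂_x`. -/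
def iterHausdorff {n : ℕ} (β : Multiset (Fin n)) : NCPoly n →ₗ[ℚ] NCPoly n :=
  β.foldr (fun x f => hausdorff x ∘ₗ f) LinearMap.id

@[simp]
lemma iterHausdorff_zero {n : ℕ} : iterHausdorff (0 : Multiset (Fin n)) = LinearMap.id := rfl

lemma iterHausdorff_cons {n : ℕ} (x : Fin n) (β : Multiset (Fin n)) :
    iterHausdorff (x ::ₘ β) = hausdorff x ∘ₗ iterHausdorff β := by
  rw [iterHausdorff, Multiset.foldr_cons, iterHausdorff]

lemma iterHausdorff_cons' {n : ℕ} (x : Fin n) (β : Multiset (Fin n)) :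
    iterHausdorff (x ::ₘ β) = iterHausdorff β ∘ₗ hausdorff x := by
  induction β using Multiset.induction with
  | empty => rfl
  | cons y β ih =>
    rw [Multiset.cons_swap, iterHausdorff_cons, ih, iterHausdorff_cons, LinearMap.comp_assoc]

lemma iterHausdorff_permRep {n : ℕ} (β : Multiset (Fin n)) (σ : Equiv.Perm (Fin n))
    (f : NCPoly n) :
    iterHausdorff (β.map σ) (permRep n σ f) = permRep n σ (iterHausdorff β f) := by
  induction β using Multiset.induction with
  | empty => rfl
  | cons y β ih =>
    rw [Multiset.map_cons, iterHausdorff_cons, iterHausdorff_cons, LinearMap.comp_apply, ih,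
      hausdorff_permRep, LinearMap.comp_apply]

lemma mem_derivedEnveloping {n : ℕ} {a : NCPoly n} :
    a ∈ (derivedEnveloping n).toSubmodule ↔ ∀ x, hausdorff x a = 0 := by
  simp [derivedEnveloping]

/-- The pairing of iterated derivatives with words of the same length. -/
lemma iterHausdorff_word_mul {n : ℕ} (β : Multiset (Fin n)) (l : List (Fin n))
    (h : β.card = l.length) :
    ∃ c : ℕ, (c ≠ 0 ↔ β = ↑l) ∧ ∀ a ∈ (derivedEnveloping n).toSubmodule,
      iterHausdorff β (MonoidAlgebra.single (FreeMonoid.ofList l) 1 * a) = c • a := by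
  induction β using Multiset.induction generalizing l with
  | empty =>
    obtain rfl : l = [] := List.length_eq_zero_iff.1 h.symm
    refine ⟨1, by simp, fun a _ => ?_⟩
    rw [FreeMonoid.ofList_nil, ← MonoidAlgebra.one_def]
    simp
  | cons x β ih =>
    rw [Multiset.card_cons] at h
    have h' : ∀ i : Fin l.length, β.card = (l.eraseIdx i).length := fun i => by
      rw [List.length_eraseIdx, if_pos i.2]
      omega
    choose c hc hca using fun i : Fin l.length => ih (l.eraseIdx i) (h' i)
    -- One application of `∂_x` deletes each occurrence of `x` in `l`; the coefficients are natural
    -- numbers, so no cancellation can occur and the sum is nonzero as soon as one term is.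
    refine ⟨∑ i, if l[i] = x then c i else 0, ?_, fun a ha => ?_⟩
    · simp only [ne_eq, Finset.sum_eq_zero_iff, Finset.mem_univ, true_imp_iff, ite_eq_right_iff,
        not_forall, exists_prop]
      constructor
      · rintro ⟨i, rfl, hi⟩
        rw [(hc i).1 hi, Multiset.cons_coe, Multiset.coe_eq_coe]
        exact List.getElem_cons_eraseIdx_perm i.2
      · intro e
        have hx : x ∈ l := by
          rw [← Multiset.mem_coe, ← e]
          exact Multiset.mem_cons_self _ _
        obtain ⟨i, hi, rfl⟩ := List.getElem_of_mem hx
        refine ⟨⟨i, hi⟩, rfl, (hc _).2 ?_⟩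
        have := Multiset.coe_eq_coe.2 (List.getElem_cons_eraseIdx_perm hi)
        rw [← e, ← Multiset.cons_coe] at this
        exact ((Multiset.cons_inj_right _).1 this).symm
    · rw [iterHausdorff_cons', LinearMap.comp_apply, hausdorff_single_mul,
        mem_derivedEnveloping.1 ha, mul_zero, add_zero, deleteSum, FreeMonoid.toList_ofList,
        Finset.sum_range, Finset.sum_mul, map_sum, Finset.sum_smul]
      refine Finset.sum_congr rfl fun i _ => ?_
      rw [List.getElem?_eq_getElem i.2]
      by_cases hi : l[i] = x
      · rw [if_pos hi, if_pos (show some l[(i : ℕ)] = some x from congrArg some hi),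
          hca i a ha]
      · rw [if_neg hi, if_neg (show some l[(i : ℕ)] ≠ some x from fun e => hi (Option.some.inj e))]
        simp

/-! ### Degrees -/

lemma single_mem_homogeneousPart {n k : ℕ} {w : FreeMonoid (Fin n)} (hw : w.length = k) (r : ℚ) :
    MonoidAlgebra.single w r ∈ (homogeneousPart n k).toSubmodule := by
  rw [homogeneousPart, MonoidAlgebra.mem_supported]
  intro v hv
  have := Finsupp.support_single_subset hv
  rw [Finset.mem_singleton] at this
  simpa [this] using hw

lemma homogeneousPart_induction {n k : ℕ} {N : Submodule ℚ (NCPoly n)} {f : NCPoly n →ₗ[ℚ] NCPoly n}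
    (hf : ∀ w : FreeMonoid (Fin n), w.length = k → f (MonoidAlgebra.single w 1) ∈ N) {a : NCPoly n}
    (ha : a ∈ (homogeneousPart n k).toSubmodule) : f a ∈ N := by
  have : (homogeneousPart n k).toSubmodule ≤ N.comap f := by
    change MonoidAlgebra.supported ℚ ℚ {w : FreeMonoid (Fin n) | w.length = k} ≤ _
    rw [MonoidAlgebra.supported_eq_span_single, Submodule.span_le]
    rintro _ ⟨w, hw, rfl⟩
    exact hf w hw
  exact this ha

lemma hausdorff_mem_homogeneousPart {n k : ℕ} (x : Fin n) {a : NCPoly n}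
    (ha : a ∈ (homogeneousPart n (k + 1)).toSubmodule) :
    hausdorff x a ∈ (homogeneousPart n k).toSubmodule := by
  refine homogeneousPart_induction (fun w hw => ?_) ha
  rw [hausdorff_single, deleteSum]
  refine Submodule.sum_mem _ fun i hi => ?_
  split_ifs
  · refine single_mem_homogeneousPart ?_ _
    have hw' : w.toList.length = k + 1 := hw
    have := Finset.mem_range.1 hi
    change (w.toList.eraseIdx i).length = k
    rw [List.length_eraseIdx, if_pos this, hw', Nat.add_sub_cancel]
  · exact Submodule.zero_mem _

lemma hausdorff_eq_zero {n : ℕ} (x : Fin n) {a : NCPoly n}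
    (ha : a ∈ (homogeneousPart n 0).toSubmodule) : hausdorff x a = 0 := by
  refine (Submodule.mem_bot ℚ).1 (homogeneousPart_induction (fun w hw => ?_) ha)
  have hw' : w.toList.length = 0 := hw
  rw [hausdorff_single, deleteSum, hw']
  simp

lemma iterHausdorff_mem_homogeneousPart {n k : ℕ} (β : Multiset (Fin n)) {a : NCPoly n}
    (ha : a ∈ (homogeneousPart n (k + β.card)).toSubmodule) :
    iterHausdorff β a ∈ (homogeneousPart n k).toSubmodule := by
  induction β using Multiset.induction generalizing a with
  | empty => simpa using ha
  | cons x β ih =>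
    rw [Multiset.card_cons, ← add_assoc] at ha
    rw [iterHausdorff_cons', LinearMap.comp_apply]
    exact ih (hausdorff_mem_homogeneousPart x ha)

lemma single_mul_mem_homogeneousPart {n k : ℕ} (w : FreeMonoid (Fin n)) {a : NCPoly n}
    (ha : a ∈ (homogeneousPart n k).toSubmodule) :
    MonoidAlgebra.single w 1 * a ∈ (homogeneousPart n (k + w.length)).toSubmodule := by
  refine homogeneousPart_induction (f := LinearMap.mulLeft ℚ (MonoidAlgebra.single w 1))
    (fun v hv => ?_) ha
  rw [LinearMap.mulLeft_apply, MonoidAlgebra.single_mul_single]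
  refine single_mem_homogeneousPart ?_ _
  rw [FreeMonoid.length_mul, hv, add_comm]

/-! ### The filtration by order of annihilating derivatives -/

/-- The noncommutative polynomials all of whose iterated derivatives of order `d` vanish. -/
def derivFiltration (n d : ℕ) : Subrepresentation (permRep n) where
  toSubmodule := ⨅ β : Sym (Fin n) d, LinearMap.ker (iterHausdorff (β : Multiset (Fin n)))
  apply_mem_toSubmodule σ f hf := by
    simp only [Submodule.mem_iInf, LinearMap.mem_ker] at hf ⊢
    intro β
    have := iterHausdorff_permRep (β.map (σ⁻¹ : Equiv.Perm (Fin n)) : Sym (Fin n) d) σ f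
    rw [hf, map_zero, Sym.coe_map, Multiset.map_map] at this
    simpa using this

lemma mem_derivFiltration {n d : ℕ} {a : NCPoly n} :
    a ∈ (derivFiltration n d).toSubmodule ↔
      ∀ β : Sym (Fin n) d, iterHausdorff (β : Multiset (Fin n)) a = 0 := by
  simp [derivFiltration]

lemma iterHausdorff_mem_of_mem_derivFiltration {n d : ℕ} {a : NCPoly n}
    (ha : a ∈ (derivFiltration n (d + 1)).toSubmodule) (β : Sym (Fin n) d) :
    iterHausdorff (β : Multiset (Fin n)) a ∈ (derivedEnveloping n).toSubmodule := by
  refine mem_derivedEnveloping.2 fun x => ?_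
  have := mem_derivFiltration.1 ha (x ::ₛ β)
  rwa [Sym.coe_cons, iterHausdorff_cons] at this

lemma mem_derivFiltration_succ {n d : ℕ} {a : NCPoly n}
    (ha : ∀ β : Sym (Fin n) d,
      iterHausdorff (β : Multiset (Fin n)) a ∈ (derivedEnveloping n).toSubmodule) :
    a ∈ (derivFiltration n (d + 1)).toSubmodule := by
  refine mem_derivFiltration.2 fun γ => ?_
  obtain ⟨x, β, rfl⟩ := Sym.exists_eq_cons_of_succ γ
  rw [Sym.coe_cons, iterHausdorff_cons]
  exact mem_derivedEnveloping.1 (ha β) x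

lemma derivFiltration_zero_inf (n k : ℕ) :
    derivFiltration n 0 ⊓ homogeneousPart n k = ⊥ := by
  refine Subrepresentation.toSubmodule_injective (eq_bot_iff.2 fun a ha => ?_)
  simpa using mem_derivFiltration.1 ha.1 Sym.nil

/-- Each derivative lowers the degree by one, so `k + 1` of them annihilate degree `k`; the
filtration is exhausted in each degree. -/
lemma derivFiltration_succ_inf (n k : ℕ) :
    derivFiltration n (k + 1) ⊓ homogeneousPart n k = homogeneousPart n k := by
  refine inf_eq_right.2 fun a ha => mem_derivFiltration.2 fun γ => ?_
  obtain ⟨x, β, rfl⟩ := Sym.exists_eq_cons_of_succ γ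
  rw [Sym.coe_cons, iterHausdorff_cons]
  refine hausdorff_eq_zero x (iterHausdorff_mem_homogeneousPart _ ?_)
  rw [Sym.card_coe, zero_add]
  exact ha

/-- The symbol map, sending an element of order at most `d` to its derivatives of order `d`. -/
def symbol (n d j : ℕ) : (derivFiltration n (d + 1) ⊓ homogeneousPart n (j + d)).toSubmodule →ₗ[ℚ]
    (Sym (Fin n) d → (derivedEnveloping n ⊓ homogeneousPart n j).toSubmodule) :=
  LinearMap.pi fun β => (iterHausdorff (β : Multiset (Fin n))).restrict fun a ha =>
    ⟨iterHausdorff_mem_of_mem_derivFiltration ha.1 β,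
      iterHausdorff_mem_homogeneousPart _ (by rw [Sym.card_coe]; exact ha.2)⟩

lemma coe_symbol_apply {n d j : ℕ}
    (a : (derivFiltration n (d + 1) ⊓ homogeneousPart n (j + d)).toSubmodule)
    (β : Sym (Fin n) d) :
    (symbol n d j a β : NCPoly n) = iterHausdorff (β : Multiset (Fin n)) (a : NCPoly n) := rfl

lemma symbol_surjective (n d j : ℕ) : Function.Surjective (symbol n d j) := by
  intro f
  have hlen : ∀ β : Sym (Fin n) d, (β : Multiset (Fin n)).toList.length = d := fun β => by
    rw [Multiset.length_toList, Sym.card_coe]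
  choose c hc hca using fun γ β : Sym (Fin n) d =>
    iterHausdorff_word_mul (γ : Multiset (Fin n)) (β : Multiset (Fin n)).toList
      (by rw [hlen, Sym.card_coe])
  -- One word is chosen for each multiset. The matrix of coefficients `c γ β` is then diagonal with
  -- nonzero diagonal, so it is inverted by dividing by `c β β`.
  let t : NCPoly n := ∑ β : Sym (Fin n) d, (c β β : ℚ)⁻¹ •
    (MonoidAlgebra.single (FreeMonoid.ofList (β : Multiset (Fin n)).toList) 1 * (f β : NCPoly n))
  have ht : ∀ γ : Sym (Fin n) d, iterHausdorff (γ : Multiset (Fin n)) t = f γ := by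
    intro γ
    rw [map_sum, Finset.sum_eq_single γ]
    · have h0 : (c γ γ : ℚ) ≠ 0 := by
        rw [Nat.cast_ne_zero, hc, Multiset.coe_toList]
      rw [map_smul, hca γ γ _ (f γ).2.1, ← Nat.cast_smul_eq_nsmul ℚ, smul_smul,
        inv_mul_cancel₀ h0, one_smul]
    · intro β _ hβ
      have h0 : c γ β = 0 := by
        by_contra h
        rw [← ne_eq, hc, Multiset.coe_toList] at h
        exact hβ (Subtype.ext h.symm)
      rw [map_smul, hca γ β _ (f β).2.1, h0, zero_smul, smul_zero]
    · exact fun h => absurd (Finset.mem_univ _) h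
  have ht1 : t ∈ (derivFiltration n (d + 1)).toSubmodule :=
    mem_derivFiltration_succ fun β => by rw [ht]; exact (f β).2.1
  have ht2 : t ∈ (homogeneousPart n (j + d)).toSubmodule := by
    refine Submodule.sum_mem _ fun β _ => Submodule.smul_mem _ _ ?_
    have := single_mul_mem_homogeneousPart
      (FreeMonoid.ofList (β : Multiset (Fin n)).toList) (f β).2.2
    have hl : (FreeMonoid.ofList (β : Multiset (Fin n)).toList).length = d := hlen β
    rwa [hl] at this
  refine ⟨⟨t, ht1, ht2⟩, funext fun β => Subtype.ext ?_⟩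
  rw [coe_symbol_apply, ht]

/-- The number of multisets of `d` letters that are fixed by `σ`. -/
def symFix {n : ℕ} (σ : Equiv.Perm (Fin n)) (d : ℕ) : ℕ :=
  (Finset.univ.filter fun β : Sym (Fin n) d => β.map σ = β).card

/-- The symbol map has kernel the previous filtration step and intertwines `σ` with a permutation of
the multisets combined with the action on `A'_n`; only the fixed multisets contribute to the trace.
-/
lemma character_derivFiltration_succ (n d j : ℕ) (σ : Equiv.Perm (Fin n)) :
    (derivFiltration n (d + 1) ⊓ homogeneousPart n (j + d)).toRepresentation.character σ =
      (derivFiltration n d ⊓ homogeneousPart n (j + d)).toRepresentation.character σ +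
        symFix σ d * (derivedEnveloping n ⊓ homogeneousPart n j).toRepresentation.character σ := by
  have hle : (derivFiltration n d ⊓ homogeneousPart n (j + d)).toSubmodule ≤
      (derivFiltration n (d + 1) ⊓ homogeneousPart n (j + d)).toSubmodule := fun a ha =>
    ⟨mem_derivFiltration_succ fun β => by
      rw [mem_derivFiltration.1 ha.1]; exact Submodule.zero_mem _, ha.2⟩
  -- The action on functions `f` of multisets is `β ↦ σ (f (σ⁻¹ β))`, which is why the inverse
  -- appears.
  have hfix : symFix σ d =
      (Finset.univ.filter fun β : Sym (Fin n) d => β.map (σ⁻¹ : Equiv.Perm (Fin n)) = β).card := by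
    refine congrArg Finset.card (Finset.filter_congr fun β _ => ?_)
    constructor <;> intro h <;> nth_rewrite 1 [← h] <;> rw [Sym.map_map] <;> simp
  rw [Representation.character, Representation.character, Representation.character, hfix,
    ← trace_pi_perm (fun β : Sym (Fin n) d => β.map (σ⁻¹ : Equiv.Perm (Fin n)))]
  refine trace_eq_add_of_exact (i := Submodule.inclusion hle) (Submodule.inclusion_injective hle)
    (symbol_surjective n d j) ?_ rfl ?_
  · intro a
    constructor
    · intro ha
      refine ⟨⟨a, mem_derivFiltration.2 fun β => ?_, a.2.2⟩, rfl⟩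
      rw [← coe_symbol_apply, ha]
      rfl
    · rintro ⟨b, rfl⟩
      exact funext fun β => Subtype.ext (mem_derivFiltration.1 b.2.1 β)
  · refine LinearMap.ext fun a => funext fun β => Subtype.ext ?_
    change iterHausdorff (β : Multiset (Fin n)) (permRep n σ a) =
      permRep n σ (iterHausdorff _ (a : NCPoly n))
    rw [← iterHausdorff_permRep, Sym.coe_map, Multiset.map_map]
    simp

/-- The bound on `d` forces `e ≤ k`, so `k - e` is a genuine difference. -/
lemma character_derivFiltration (n d k : ℕ) (hd : d ≤ k + 1) (σ : Equiv.Perm (Fin n)) :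
    (derivFiltration n d ⊓ homogeneousPart n k).toRepresentation.character σ =
      ∑ e ∈ Finset.range d, symFix σ e *
        (derivedEnveloping n ⊓ homogeneousPart n (k - e)).toRepresentation.character σ := by
  induction d with
  | zero =>
    rw [derivFiltration_zero_inf, Finset.sum_range_zero, Representation.character]
    have : Subsingleton (⊥ : Subrepresentation (permRep n)).toSubmodule :=
      inferInstanceAs (Subsingleton (⊥ : Submodule ℚ (NCPoly n)))
    rw [Subsingleton.elim ((⊥ : Subrepresentation (permRep n)).toRepresentation σ) 0, map_zero]
  | succ d ih =>
    obtain ⟨j, rfl⟩ := Nat.exists_eq_add_of_le' (Nat.le_of_succ_le_succ hd)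
    rw [character_derivFiltration_succ, ih (by omega), Finset.sum_range_succ, Nat.add_sub_cancel]

/-! ### The character of the space of words -/

/-- A word is fixed exactly when each of its letters is. -/
lemma card_words_fixed (n k : ℕ) (σ : Equiv.Perm (Fin n)) :
    Nat.card {w : FreeMonoid (Fin n) // w.length = k ∧ FreeMonoid.map σ w = w} =
      Fintype.card {x // σ x = x} ^ k := by
  let e : {w : FreeMonoid (Fin n) // w.length = k ∧ FreeMonoid.map σ w = w} ≃
      List.Vector {x // σ x = x} k :=
    { toFun := fun w => ⟨w.1.toList.attachWith (fun x => σ x = x) (fun x hx => by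
          have h := congrArg FreeMonoid.toList w.2.2
          rw [FreeMonoid.toList_map] at h
          exact List.map_inj_left.1 (h.trans (List.map_id _).symm) x hx), by
        rw [List.length_attachWith]
        exact w.2.1⟩
      invFun := fun v => ⟨FreeMonoid.ofList (v.1.map Subtype.val), by
        refine ⟨(List.length_map _).trans v.2, FreeMonoid.toList.injective ?_⟩
        rw [FreeMonoid.toList_map, FreeMonoid.toList_ofList, List.map_map]
        exact List.map_congr_left fun x _ => x.2⟩
      left_inv := fun w => Subtype.ext (by simp)
      right_inv := fun v => Subtype.ext (by
        apply List.map_injective_iff.2 Subtype.val_injective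
        simp) }
  rw [Nat.card_congr e, Nat.card_eq_fintype_card, card_vector]

lemma character_homogeneousPart (n k : ℕ) (σ : Equiv.Perm (Fin n)) :
    (homogeneousPart n k).toRepresentation.character σ =
      (Fintype.card {x // σ x = x} : ℚ) ^ k := by
  classical
  let S : Set (FreeMonoid (Fin n)) := {w | w.length = k}
  have : Finite S := List.finite_length_eq (Fin n) k
  have := Fintype.ofFinite S
  let b : Module.Basis S ℚ (homogeneousPart n k).toSubmodule :=
    .ofRepr (MonoidAlgebra.supportedEquivFinsupp S)
  have hr : ∀ (a : (homogeneousPart n k).toSubmodule) (w : S),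
      b.repr a w = (a : NCPoly n).coeff w := fun a w => rfl
  have hb : ∀ w : S, b w = ⟨MonoidAlgebra.single w.1 1, single_mem_homogeneousPart w.2 1⟩ := by
    refine fun w => b.repr.injective (Finsupp.ext fun v => ?_)
    rw [b.repr_self, hr]
    simp [Finsupp.single_apply, Subtype.ext_iff]
  have hcard : Nat.card {w : FreeMonoid (Fin n) // w.length = k ∧ FreeMonoid.map σ w = w} =
      (Finset.univ.filter fun w : S => FreeMonoid.map σ w.1 = w.1).card := by
    rw [← Fintype.card_subtype, ← Nat.card_eq_fintype_card]
    exact Nat.card_congr (Equiv.subtypeSubtypeEquivSubtypeInter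
      (fun w : FreeMonoid (Fin n) => w.length = k) (fun w => FreeMonoid.map σ w = w)).symm
  rw [Representation.character, LinearMap.trace_eq_matrix_trace ℚ b, Matrix.trace,
    ← Nat.cast_pow, ← card_words_fixed, hcard, Finset.card_filter, Nat.cast_sum]
  refine Finset.sum_congr rfl fun w _ => ?_
  rw [Matrix.diag_apply, LinearMap.toMatrix_apply, hr, hb]
  change (permRep n σ (MonoidAlgebra.single w.1 1)).coeff w = _
  simp [permRep, Finsupp.single_apply]

/-! ### Counting multisets fixed by a permutation -/

section CycleClasses

open Classical in
/-- The number of elements of an orbit of a permutation. -/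
def classSize {α : Type*} [Fintype α] (σ : Equiv.Perm α)
    (q : Quotient (Equiv.Perm.SameCycle.setoid σ)) : ℕ :=
  (Finset.univ.filter fun x : α => Quotient.mk _ x = q).card

lemma mk_eq_iff_sameCycle {α : Type*} {σ : Equiv.Perm α} {x : α}
    {q : Quotient (Equiv.Perm.SameCycle.setoid σ)} :
    Quotient.mk _ x = q ↔ σ.SameCycle q.out x := by
  conv_lhs => rw [← q.out_eq]
  exact Quotient.eq.trans ⟨fun h => h.symm, fun h => h.symm⟩

lemma classSize_pos {α : Type*} [Fintype α] (σ : Equiv.Perm α)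
    (q : Quotient (Equiv.Perm.SameCycle.setoid σ)) : 0 < classSize σ q :=
  Finset.card_pos.2 ⟨q.out, by simp⟩

open Classical in
lemma classSize_eq_card_support {α : Type*} [Fintype α] [DecidableEq α] {σ : Equiv.Perm α}
    {q : Quotient (Equiv.Perm.SameCycle.setoid σ)} (hq : σ q.out ≠ q.out) :
    classSize σ q = (σ.cycleOf q.out).support.card := by
  refine congrArg Finset.card (Finset.ext fun x => ?_)
  rw [Equiv.Perm.mem_support_cycleOf_iff' hq, ← mk_eq_iff_sameCycle]
  simp

open Classical in
lemma classSize_eq_one {α : Type*} [Fintype α] {σ : Equiv.Perm α}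
    {q : Quotient (Equiv.Perm.SameCycle.setoid σ)} (hq : σ q.out = q.out) :
    classSize σ q = 1 := by
  refine Finset.card_eq_one.2 ⟨q.out, Finset.ext fun x => ?_⟩
  rw [Finset.mem_filter, mk_eq_iff_sameCycle, Finset.mem_singleton]
  constructor
  · rintro ⟨-, i, rfl⟩
    exact Equiv.Perm.zpow_apply_eq_self_of_apply_eq_self hq i
  · rintro rfl
    exact ⟨Finset.mem_univ _, Equiv.Perm.SameCycle.refl _ _⟩

open Classical in
/-- The parts of the cycle type of a permutation are the sizes of its orbits. -/
lemma prod_classSize {α M : Type*} [Fintype α] [DecidableEq α] [CommMonoid M] (σ : Equiv.Perm α)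
    (F : ℕ → M) : ∏ q, F (classSize σ q) = (σ.partition.parts.map F).prod := by
  rw [Equiv.Perm.parts_partition, Multiset.map_add, Multiset.prod_add, Multiset.map_replicate,
    Multiset.prod_replicate, Equiv.Perm.cycleType, Multiset.map_map,
    ← Finset.prod_filter_mul_prod_filter_not Finset.univ
      (fun q : Quotient (Equiv.Perm.SameCycle.setoid σ) => σ q.out ≠ q.out)]
  congr 1
  -- Nontrivial orbits correspond to the cycle factors of `σ`; the remaining orbits correspond to
  -- its fixed points, the parts equal to 1.
  · refine Finset.prod_bij (fun q _ => σ.cycleOf q.out) ?_ ?_ ?_ ?_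
    · intro q hq
      rw [Equiv.Perm.cycleOf_mem_cycleFactorsFinset_iff, Equiv.Perm.mem_support]
      exact (Finset.mem_filter.1 hq).2
    · intro q hq q' hq' h
      rw [← Equiv.Perm.sameCycle_iff_cycleOf_eq_of_mem_support
        (Equiv.Perm.mem_support.2 (Finset.mem_filter.1 hq).2)
        (Equiv.Perm.mem_support.2 (Finset.mem_filter.1 hq').2)] at h
      rw [← mk_eq_iff_sameCycle, q'.out_eq] at h
      exact h.symm
    · intro c hc
      obtain ⟨x, hx⟩ := (Equiv.Perm.mem_cycleFactorsFinset_iff.1 hc).1.nonempty_support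
      have hcx := Equiv.Perm.cycle_is_cycleOf hx hc
      have hxs : x ∈ σ.support := Equiv.Perm.mem_cycleFactorsFinset_support_le hc hx
      have hs : σ.SameCycle (Quotient.mk (Equiv.Perm.SameCycle.setoid σ) x).out x :=
        mk_eq_iff_sameCycle.1 rfl
      refine ⟨Quotient.mk _ x, ?_, ?_⟩
      · rw [Finset.mem_filter]
        refine ⟨Finset.mem_univ _, fun h => ?_⟩
        exact Equiv.Perm.mem_support.1 hxs (hs.apply_eq_self_iff.1 h)
      · rw [hcx, hs.cycleOf_eq]
    · intro q hq
      rw [classSize_eq_card_support (Finset.mem_filter.1 hq).2]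
      rfl
  · rw [Finset.prod_congr rfl (g := fun _ => F 1) fun q hq => by
      rw [classSize_eq_one (not_not.1 (Finset.mem_filter.1 hq).2)], Finset.prod_const]
    congr 1
    rw [← Finset.card_compl]
    refine Finset.card_bij (fun q _ => q.out) ?_ ?_ ?_
    · intro q hq
      simpa using hq
    · intro q _ q' _ h
      rw [← q.out_eq, ← q'.out_eq, h]
    · intro x hx
      have hx' : σ x = x := by simpa using hx
      have hs : σ.SameCycle x (Quotient.mk (Equiv.Perm.SameCycle.setoid σ) x).out :=
        (mk_eq_iff_sameCycle.1 rfl).symm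
      obtain ⟨i, hi⟩ := hs
      rw [Equiv.Perm.zpow_apply_eq_self_of_apply_eq_self hx'] at hi
      exact ⟨Quotient.mk _ x, by simp [← hi, hx'], hi.symm⟩

/-- A function that is constant along a permutation is constant on its orbits. -/
lemma eq_of_sameCycle {α β : Type*} {σ : Equiv.Perm α} {f : α → β} (hf : ∀ x, f (σ x) = f x)
    {x y : α} (h : σ.SameCycle x y) : f x = f y := by
  let S : Subgroup (Equiv.Perm α) :=
    { carrier := {τ | ∀ x, f (τ x) = f x}
      mul_mem' := fun {a b} ha hb x => (ha _).trans (hb x)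
      one_mem' := fun x => rfl
      inv_mem' := fun {a} ha x => by simpa using (ha (a⁻¹ x)).symm }
  obtain ⟨i, rfl⟩ := h
  exact (S.zpow_mem (show σ ∈ S from hf) i x).symm

lemma sum_comp_mk {α : Type*} [Fintype α] (σ : Equiv.Perm α)
    [Fintype (Quotient (Equiv.Perm.SameCycle.setoid σ))]
    (g : Quotient (Equiv.Perm.SameCycle.setoid σ) → ℕ) :
    ∑ x, g (Quotient.mk _ x) = ∑ q, classSize σ q * g q := by
  classical
  rw [← Finset.sum_fiberwise Finset.univ (fun x => Quotient.mk (Equiv.Perm.SameCycle.setoid σ) x)]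
  refine Finset.sum_congr rfl fun q _ => ?_
  rw [Finset.sum_congr rfl (g := fun _ => g q) fun x hx => by rw [(Finset.mem_filter.1 hx).2],
    Finset.sum_const, classSize, smul_eq_mul]

end CycleClasses

-- A fixed multiset has constant multiplicity on each orbit. Recording the total multiplicity per
-- orbit, a multiple of the orbit size, puts the count in the form of a coefficient of a product of
-- geometric series.
open Classical in
lemma symFix_eq_card {n : ℕ} (σ : Equiv.Perm (Fin n)) (d : ℕ) :
    symFix σ d = ((Finset.univ.finsuppAntidiag d).filter
      fun l : Quotient (Equiv.Perm.SameCycle.setoid σ) →₀ ℕ => ∀ q, classSize σ q ∣ l q).card := by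
  have hcount : ∀ β : Sym (Fin n) d, β.map σ = β → ∀ x,
      (β : Multiset (Fin n)).count (σ x) = (β : Multiset (Fin n)).count x := by
    intro β hβ x
    conv_lhs => rw [← hβ, Sym.coe_map, Multiset.count_map_eq_count' _ _ σ.injective]
  have hout : ∀ β : Sym (Fin n) d, β.map σ = β → ∀ x, (β : Multiset (Fin n)).count
      (Quotient.mk (Equiv.Perm.SameCycle.setoid σ) x).out = (β : Multiset (Fin n)).count x :=
    fun β hβ x => eq_of_sameCycle (f := fun x => (β : Multiset (Fin n)).count x) (hcount β hβ)
      (mk_eq_iff_sameCycle.1 rfl)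
  have hmk : ∀ x, Quotient.mk (Equiv.Perm.SameCycle.setoid σ) (σ x) = Quotient.mk _ x := fun x =>
    Quotient.sound (Equiv.Perm.sameCycle_apply_left.2 (Equiv.Perm.SameCycle.refl _ _))
  refine Finset.card_bij (fun β _ => Finsupp.equivFunOnFinite.symm fun q =>
    classSize σ q * (β : Multiset (Fin n)).count q.out) ?_ ?_ ?_
  · intro β hβ
    rw [Finset.mem_filter, Finset.mem_finsuppAntidiag]
    refine ⟨⟨?_, Finset.subset_univ _⟩, fun q => dvd_mul_right _ _⟩
    change ∑ q, classSize σ q * (β : Multiset (Fin n)).count q.out = d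
    rw [← sum_comp_mk σ fun q => (β : Multiset (Fin n)).count q.out]
    rw [Finset.sum_congr rfl fun x _ => hout β (Finset.mem_filter.1 hβ).2 x,
      Multiset.sum_count_eq_card fun _ _ => Finset.mem_univ _, Sym.card_coe]
  · intro β hβ γ hγ h
    refine Subtype.ext (Multiset.ext.2 fun x => ?_)
    have hq := DFunLike.congr_fun h (Quotient.mk _ x)
    have hq' := Nat.eq_of_mul_eq_mul_left (classSize_pos σ _) hq
    rwa [hout β (Finset.mem_filter.1 hβ).2, hout γ (Finset.mem_filter.1 hγ).2] at hq'
  · intro l hl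
    obtain ⟨hl, hdvd⟩ := Finset.mem_filter.1 hl
    have hsum := (Finset.mem_finsuppAntidiag.1 hl).1
    choose g hg using hdvd
    have hgsum : ∑ x, g (Quotient.mk _ x) = d := by
      rw [sum_comp_mk, ← hsum]
      exact Finset.sum_congr rfl fun q _ => (hg q).symm
    let β : Sym (Fin n) d :=
      (Sym.equivNatSumOfFintype (Fin n) d).symm ⟨fun x => g (Quotient.mk _ x), hgsum⟩
    have hβ : ∀ x, (β : Multiset (Fin n)).count x = g (Quotient.mk _ x) := fun x => by
      rw [← Sym.coe_equivNatSumOfFintype_apply_apply, Equiv.apply_symm_apply]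
    refine ⟨β, Finset.mem_filter.2 ⟨Finset.mem_univ _, Subtype.ext (Multiset.ext.2 fun x => ?_)⟩,
      Finsupp.ext fun q => ?_⟩
    · obtain ⟨y, rfl⟩ := σ.surjective x
      change ((β.map σ : Sym (Fin n) d) : Multiset (Fin n)).count (σ y) =
        (β : Multiset (Fin n)).count (σ y)
      rw [Sym.coe_map, Multiset.count_map_eq_count' _ _ σ.injective, hβ, hβ, hmk]
    · change classSize σ q * (β : Multiset (Fin n)).count q.out = l q
      rw [hβ, Quotient.out_eq, hg]

/-! ### Generating functions and the graded character -/

lemma one_sub_X_pow_mul_mk {R : Type*} [CommRing R] {m : ℕ} (hm : 0 < m) :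
    (1 - PowerSeries.X ^ m : PowerSeries R) * PowerSeries.mk (fun k => if m ∣ k then 1 else 0) =
      1 := by
  ext k
  rw [sub_mul, one_mul, map_sub, PowerSeries.coeff_mk, PowerSeries.coeff_X_pow_mul',
    PowerSeries.coeff_one, PowerSeries.coeff_mk]
  by_cases hk : m ≤ k
  · rw [if_pos hk, if_neg (by omega : k ≠ 0)]
    obtain ⟨j, rfl⟩ := Nat.exists_eq_add_of_le hk
    simp
  · rw [if_neg hk, sub_zero]
    congr 1
    refine propext ⟨fun h => ?_, fun h => h ▸ dvd_zero m⟩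
    by_contra h0
    exact hk (Nat.le_of_dvd (Nat.pos_of_ne_zero h0) h)

/-- The generating function of the numbers of fixed multisets. -/
lemma prod_mul_mk_symFix {n : ℕ} (σ : Equiv.Perm (Fin n)) :
    (σ.partition.parts.map fun m => (1 - PowerSeries.X ^ m : PowerSeries ℚ)).prod *
      PowerSeries.mk (fun d => (symFix σ d : ℚ)) = 1 := by
  classical
  have h : PowerSeries.mk (fun d => (symFix σ d : ℚ)) =
      ∏ q, PowerSeries.mk (fun k => if classSize σ q ∣ k then (1 : ℚ) else 0) := by
    ext d
    rw [PowerSeries.coeff_prod, PowerSeries.coeff_mk, symFix_eq_card, Finset.card_filter,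
      Nat.cast_sum]
    refine Finset.sum_congr rfl fun l _ => ?_
    simp only [PowerSeries.coeff_mk, Finset.prod_ite_zero, Finset.prod_const_one]
    simp
  rw [← prod_classSize, h, ← Finset.prod_mul_distrib]
  exact Finset.prod_eq_one fun q _ => one_sub_X_pow_mul_mk (classSize_pos σ q)

/-- The graded character of the space `A'_n`. -/
theorem gradedCharacter_derivedEnveloping {n : ℕ} (σ : Equiv.Perm (Fin n)) :
    (1 - (Fintype.card {x // σ x = x} : PowerSeries ℚ) * PowerSeries.X) *
        gradedCharacter (derivedEnveloping n) σ =
      (σ.partition.parts.map fun m => (1 - PowerSeries.X ^ m : PowerSeries ℚ)).prod := by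
  -- In degree `k`, filtration step `k + 1` is the whole space of words, and its character is the
  -- convolution coefficient.
  have h : PowerSeries.mk (fun d => (symFix σ d : ℚ)) * gradedCharacter (derivedEnveloping n) σ =
      PowerSeries.mk fun k => (Fintype.card {x // σ x = x} : ℚ) ^ k := by
    ext k
    rw [PowerSeries.coeff_mk, ← character_homogeneousPart, ← derivFiltration_succ_inf,
      character_derivFiltration n (k + 1) k le_rfl, PowerSeries.coeff_mul,
      Finset.Nat.sum_antidiagonal_eq_sum_range_succ_mk]
    simp [gradedCharacter]
  have h2 : (1 - (Fintype.card {x // σ x = x} : PowerSeries ℚ) * PowerSeries.X) *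
      PowerSeries.mk (fun k => (Fintype.card {x // σ x = x} : ℚ) ^ k) = 1 := by
    ext k
    rw [sub_mul, one_mul, mul_assoc, map_sub, PowerSeries.coeff_mk, PowerSeries.coeff_one,
      ← map_natCast (PowerSeries.C (R := ℚ)), PowerSeries.coeff_C_mul]
    cases k with
    | zero => simp
    | succ k => simp [PowerSeries.coeff_succ_X_mul, pow_succ, mul_comm]
  have h1 := prod_mul_mk_symFix σ
  generalize (σ.partition.parts.map fun m => (1 - PowerSeries.X ^ m : PowerSeries ℚ)).prod = P
    at h1 ⊢
  generalize (1 - (Fintype.card {x // σ x = x} : PowerSeries ℚ) * PowerSeries.X) = u at h2 ⊢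
  linear_combination (-(u * gradedCharacter (derivedEnveloping n) σ)) * h1 + u * P * h + P * h2

/-! ### Symmetric function identities -/

/-- The expansion of `1 / (1 - mq)` in the series `q^d / {q;q}_d`. -/
lemma one_sub_mul_sum_braceQ {m n : ℕ} (hm : m ≤ n) :
    (1 - (m : PowerSeries ℚ) * PowerSeries.X) * ∑ d ∈ Finset.range (n + 1),
      (m.descFactorial d : PowerSeries ℚ) * (PowerSeries.X ^ d * (braceQ d)⁻¹) = 1 := by
  have hB : ∀ d, (1 - ((d + 1 : ℕ) : PowerSeries ℚ) * PowerSeries.X) * (braceQ (d + 1))⁻¹ =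
      (braceQ d)⁻¹ := by
    have hc : ∀ d, PowerSeries.constantCoeff (braceQ d) ≠ 0 := fun d => by
      simp [braceQ, map_prod]
    intro d
    rw [PowerSeries.eq_inv_iff_mul_eq_one (hc d)]
    have hinv := PowerSeries.mul_inv_cancel _ (hc (d + 1))
    generalize (braceQ (d + 1))⁻¹ = b at hinv ⊢
    rw [braceQ, Finset.prod_Icc_succ_top (by omega), ← braceQ] at hinv
    linear_combination hinv
  have hD : ∀ d, (m.descFactorial (d + 1) : PowerSeries ℚ) =
      ((m : PowerSeries ℚ) - d) * m.descFactorial d := by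
    intro d
    rcases le_or_gt d m with h | h
    · rw [Nat.descFactorial_succ, Nat.cast_mul, Nat.cast_sub h]
    · rw [Nat.descFactorial_eq_zero_iff_lt.2 h, Nat.descFactorial_eq_zero_iff_lt.2 (by omega)]
      simp
  -- Telescoping rests on `(1 - mq) - (1 - (k+1)q) = -(m-k-1)q`. At `k = n` the remainder contains
  -- the falling factorial of `m` of length `n + 1`, which is zero because `m ≤ n`.
  have key : ∀ k, (1 - (m : PowerSeries ℚ) * PowerSeries.X) * ∑ d ∈ Finset.range (k + 1),
      (m.descFactorial d : PowerSeries ℚ) * (PowerSeries.X ^ d * (braceQ d)⁻¹) =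
        1 - (m.descFactorial (k + 1) : PowerSeries ℚ) * (PowerSeries.X ^ (k + 1) * (braceQ k)⁻¹) := by
    intro k
    induction k with
    | zero => simp [braceQ]
    | succ k ih =>
      rw [Finset.sum_range_succ, mul_add, ih, hD (k + 1), ← hB k]
      push_cast
      ring
  rw [key, Nat.descFactorial_eq_zero_iff_lt.2 (by omega)]
  simp

/-- Adjoining a part 1 to `ν` multiplies `z ν` by the new number of parts 1, which cancels the
weight. Partitions without a part 1 have weight zero, so the truncated subtraction is harmless. -/
lemma p_one_mul_sum_partition (m : ℕ) (F : ℕ → ℚ) :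
    ∑ μ : (m + 1).Partition,
        (μ.parts.count 1 * F (μ.parts.count 1 - 1) * (z μ : ℚ)⁻¹) • pPart μ =
      p 1 * ∑ ν : m.Partition, (F (ν.parts.count 1) * (z ν : ℚ)⁻¹) • pPart ν := by
  rw [Finset.mul_sum]
  symm
  refine Finset.sum_of_injOn
    (fun ν : m.Partition => (⟨1 ::ₘ ν.parts,
      fun {i} hi => (Multiset.mem_cons.1 hi).elim (fun e => e ▸ one_pos) ν.parts_pos,
      by rw [Multiset.sum_cons, ν.parts_sum]; omega⟩ : (m + 1).Partition)) ?_ ?_ ?_ ?_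
  · intro ν _ ν' _ e
    have := congrArg Nat.Partition.parts e
    exact Nat.Partition.ext (by simpa using this)
  · intro _ _
    simp
  · intro μ _ hμ
    have : 1 ∉ μ.parts := by
      intro hmem
      refine hμ ⟨⟨μ.parts.erase 1, fun {i} hi => μ.parts_pos (Multiset.mem_of_mem_erase hi), ?_⟩,
        by simp, ?_⟩
      · have := congrArg Multiset.sum (Multiset.cons_erase hmem)
        rw [Multiset.sum_cons, μ.parts_sum] at this
        omega
      · exact Nat.Partition.ext (Multiset.cons_erase hmem)
    simp [Multiset.count_eq_zero_of_notMem this]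
  · intro ν _
    have hz := z_cons (m' := m + 1) 1 ν ⟨1 ::ₘ ν.parts,
      fun {i} hi => (Multiset.mem_cons.1 hi).elim (fun e => e ▸ one_pos) ν.parts_pos,
      by rw [Multiset.sum_cons, ν.parts_sum]; omega⟩ rfl
    have hc : ((ν.parts.count 1 : ℚ) + 1) ≠ 0 := by positivity
    have hz0 := z_ne_zero ν
    simp only [hz, pPart, Multiset.map_cons, Multiset.prod_cons, Multiset.count_cons_self,
      mul_smul_comm, Nat.add_sub_cancel]
    congr 1
    push_cast
    field_simp

/-- Each induction step splits off one factor of the falling factorial and one part 1. The equation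
`hn` is kept as a hypothesis so that `n` may be `Fintype.card (Fin n)`. -/
lemma sum_partition_descFactorial {d m n : ℕ} (hn : m + d = n) :
    ∑ μ : n.Partition, ((μ.parts.count 1).descFactorial d * (z μ : ℚ)⁻¹) • pPart μ =
      p 1 ^ d * h m := by
  subst hn
  induction d with
  | zero => simp [h]
  | succ d ih =>
    rw [pow_succ', mul_assoc, ← ih]
    refine Eq.trans ?_ (p_one_mul_sum_partition (m + d) fun c => (c.descFactorial d : ℚ))
    refine Finset.sum_congr rfl fun μ _ => ?_
    cases hc : μ.parts.count 1 with
    | zero => simp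
    | succ c => rw [Nat.succ_descFactorial_succ, Nat.cast_mul, Nat.add_sub_cancel]

/-! ### Cycle types and averages over the symmetric group -/

lemma parts_eq_filter_add_replicate {m : ℕ} (μ : m.Partition) :
    μ.parts = μ.parts.filter (2 ≤ ·) +
      Multiset.replicate (m - (μ.parts.filter (2 ≤ ·)).sum) 1 := by
  have h1 : ∀ i ∈ μ.parts.filter (¬ 2 ≤ ·), i = 1 := fun i hi => by
    have := μ.parts_pos (Multiset.mem_of_mem_filter hi)
    have := (Multiset.mem_filter.1 hi).2
    omega
  have h2 := Multiset.eq_replicate_card.2 h1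
  have h3 := congrArg Multiset.sum (Multiset.filter_add_not (2 ≤ ·) μ.parts)
  rw [Multiset.sum_add, h2, Multiset.sum_replicate, μ.parts_sum, smul_eq_mul, mul_one] at h3
  conv_lhs => rw [← Multiset.filter_add_not (2 ≤ ·) μ.parts, h2]
  congr 2
  omega

/-- Puts `z μ` in the shape of the centralizer order in `Equiv.Perm.card_of_cycleType_mul_eq`, where
fixed points are separated from the cycle type. -/
lemma z_eq_of_parts_eq {m c : ℕ} {μ : m.Partition} {s : Multiset ℕ} (hs : 1 ∉ s)
    (hμ : μ.parts = s + Multiset.replicate c 1) :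
    z μ = c.factorial * s.prod * ∏ i ∈ s.toFinset, (s.count i).factorial := by
  have h1 : 1 ∉ s.toFinset := fun h => hs (Multiset.mem_toFinset.1 h)
  have hsub : μ.parts.toFinset ⊆ insert 1 s.toFinset := by
    intro i hi
    rw [hμ, Multiset.mem_toFinset, Multiset.mem_add] at hi
    rcases hi with hi | hi
    · simp [hi]
    · simp [Multiset.eq_of_mem_replicate hi]
  rw [z, Finset.prod_subset hsub fun i _ hi => by
    rw [Multiset.mem_toFinset] at hi
    simp [Multiset.count_eq_zero_of_notMem hi], Finset.prod_insert h1, hμ, Multiset.count_add,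
    Multiset.count_eq_zero_of_notMem hs, Multiset.count_replicate_self, zero_add, one_pow, mul_one,
    mul_assoc, Finset.prod_multiset_count s, mul_comm (∏ i ∈ s.toFinset, i ^ _),
    ← Finset.prod_mul_distrib]
  congr 1
  refine Finset.prod_congr rfl fun i hi => ?_
  have : i ≠ 1 := fun e => h1 (e ▸ hi)
  rw [Multiset.count_add, Multiset.count_replicate, if_neg this.symm, add_zero]

/-- The number of permutations of a given cycle type is `n! / z_μ`. -/
lemma card_partition_eq_mul_z {α : Type*} [Fintype α] [DecidableEq α]
    (μ : (Fintype.card α).Partition) :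
    (Finset.univ.filter fun σ : Equiv.Perm α => σ.partition = μ).card * z μ =
      (Fintype.card α).factorial := by
  set s := μ.parts.filter (2 ≤ ·) with hs
  have hμ := parts_eq_filter_add_replicate μ
  rw [← hs] at hμ
  have hsum : s.sum ≤ Fintype.card α := by
    rw [← μ.parts_sum, hμ, Multiset.sum_add]
    exact Nat.le_add_right _ _
  have h2 : ∀ i ∈ s, 2 ≤ i := fun i hi => (Multiset.mem_filter.1 hi).2
  have hiff : ∀ σ : Equiv.Perm α, σ.partition = μ ↔ σ.cycleType = s := by
    intro σ
    constructor
    · rintro rfl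
      exact σ.filter_parts_partition_eq_cycleType.symm
    · intro h
      rw [Nat.Partition.ext_iff, Equiv.Perm.parts_partition, hμ, ← Equiv.Perm.sum_cycleType, h]
  have := Equiv.Perm.card_of_cycleType_mul_eq α s
  rw [if_pos ⟨hsum, h2⟩] at this
  rw [z_eq_of_parts_eq (fun h => by have := h2 1 h; omega) hμ, ← this]
  simp only [hiff]

/-- Averages over the symmetric group of functions of the cycle type. -/
lemma inv_factorial_smul_sum_perm {α M : Type*} [Fintype α] [DecidableEq α] [AddCommGroup M]
    [Module ℚ M] {n : ℕ} (hn : Fintype.card α = n) (F : (Fintype.card α).Partition → M) :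
    ((n.factorial : ℚ)⁻¹) • ∑ σ : Equiv.Perm α, F σ.partition =
      ∑ μ, (z μ : ℚ)⁻¹ • F μ := by
  rw [← hn, ← Finset.sum_fiberwise Finset.univ (fun σ : Equiv.Perm α => σ.partition), Finset.smul_sum]
  refine Finset.sum_congr rfl fun μ _ => ?_
  rw [Finset.sum_congr rfl (g := fun _ => F μ) fun σ hσ => by rw [(Finset.mem_filter.1 hσ).2],
    Finset.sum_const, ← Nat.cast_smul_eq_nsmul ℚ, smul_smul, ← card_partition_eq_mul_z μ]
  have hc : ((Finset.univ.filter fun σ : Equiv.Perm α => σ.partition = μ).card : ℚ) ≠ 0 := by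
    intro h0
    have := card_partition_eq_mul_z μ
    rw [Nat.cast_eq_zero.1 h0, zero_mul] at this
    exact Nat.factorial_ne_zero _ this.symm
  have hz := z_ne_zero μ
  congr 1
  push_cast
  field_simp

lemma count_one_partition {α : Type*} [Fintype α] [DecidableEq α] (σ : Equiv.Perm α) :
    σ.partition.parts.count 1 = Fintype.card {x // σ x = x} := by
  rw [Equiv.Perm.parts_partition, Multiset.count_add, Multiset.count_replicate_self,
    Multiset.count_eq_zero_of_notMem, zero_add, ← Finset.card_compl, Fintype.card_subtype]
  · congr 1
    ext x
    simp
  · intro h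
    have := Equiv.Perm.two_le_of_mem_cycleType h
    omega

lemma plethOneSubQ_pPart {m : ℕ} (μ : m.Partition) :
    plethOneSubQ (pPart μ) =
      MvPolynomial.C (μ.parts.map fun i => (1 - PowerSeries.X ^ i : PowerSeries ℚ)).prod *
        pPart μ := by
  rw [pPart, map_multiset_prod, map_multiset_prod, Multiset.map_map, Multiset.map_map,
    ← Multiset.prod_map_mul]
  refine congrArg Multiset.prod (Multiset.map_congr rfl fun i hi => ?_)
  have hi : 0 < i := μ.parts_pos hi
  simp [plethOneSubQ, p, hi]

lemma hList_eq (a d : ℕ) : hList (a :: List.replicate d 1) = p 1 ^ d * h a := by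
  have h1 : h 1 = p 1 := by
    rw [h, Fintype.sum_unique, Unique.default_eq (Nat.Partition.indiscrete 1)]
    simp [z, pPart]
  rw [hList, List.map_cons, List.map_replicate, List.prod_cons, List.prod_replicate, h1, mul_comm]

/-- The range of `d` does not depend on `σ`, which allows the sum over `d` to be taken outside the
average over permutations. -/
lemma gradedCharacter_eq {n : ℕ} (σ : Equiv.Perm (Fin n)) :
    gradedCharacter (derivedEnveloping n) σ =
      (∑ d ∈ Finset.range (n + 1), ((σ.partition.parts.count 1).descFactorial d : PowerSeries ℚ) *
        (PowerSeries.X ^ d * (braceQ d)⁻¹)) *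
      (σ.partition.parts.map fun m => (1 - PowerSeries.X ^ m : PowerSeries ℚ)).prod := by
  have hle : Fintype.card {x // σ x = x} ≤ n :=
    (Fintype.card_subtype_le _).trans_eq (Fintype.card_fin n)
  rw [← gradedCharacter_derivedEnveloping, count_one_partition]
  linear_combination (-gradedCharacter (derivedEnveloping n) σ) * one_sub_mul_sum_braceQ hle

end NCHarmonics

end

theorem mainTheorem3 (n : ℕ) :
    NCHarmonics.gradedFrob (NCHarmonics.derivedEnveloping n) =
      ∑ d ∈ Finset.range (n + 1),
        MvPolynomial.C (PowerSeries.X ^ d * (NCHarmonics.braceQ d)⁻¹) *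
          NCHarmonics.plethOneSubQ (NCHarmonics.hList ((n - d) :: List.replicate d 1)) := by
  open NCHarmonics in
  have hn : Fintype.card (Fin n) = n := Fintype.card_fin n
  -- The summand for `σ` depends only on its cycle type; the plethysm absorbs the factors `1 - q^i`,
  -- and being linear it can later be pulled out of the sum over `μ`.
  let F (μ : (Fintype.card (Fin n)).Partition) : SymFn := ∑ d ∈ Finset.range (n + 1),
    MvPolynomial.C (PowerSeries.X ^ d * (braceQ d)⁻¹) *
      plethOneSubQ (((μ.parts.count 1).descFactorial d : ℚ) • pPart μ)
  have hF : ∀ σ : Equiv.Perm (Fin n),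
      MvPolynomial.C (gradedCharacter (derivedEnveloping n) σ) * pPart σ.partition =
        F σ.partition := by
    intro σ
    simp only [F, Nat.cast_smul_eq_nsmul, map_nsmul, plethOneSubQ_pPart]
    rw [gradedCharacter_eq, map_mul, map_sum, mul_assoc, Finset.sum_mul]
    refine Finset.sum_congr rfl fun d _ => ?_
    rw [map_mul, map_natCast, nsmul_eq_mul]
    ring
  rw [gradedFrob, Finset.sum_congr rfl fun σ _ => hF σ, inv_factorial_smul_sum_perm hn F]
  simp only [F, Finset.smul_sum]
  rw [Finset.sum_comm]
  refine Finset.sum_congr rfl fun d hd => ?_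
  have hd' : n - d + d = Fintype.card (Fin n) := by
    rw [hn]
    exact Nat.sub_add_cancel (Nat.le_of_lt_succ (Finset.mem_range.1 hd))
  rw [hList_eq, ← sum_partition_descFactorial hd', map_sum, Finset.mul_sum]
  refine Finset.sum_congr rfl fun μ _ => ?_
  rw [mul_comm _ (z μ : ℚ)⁻¹, mul_smul, map_rat_smul plethOneSubQ (z μ : ℚ)⁻¹, mul_smul_comm]
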